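/- Let $(W,S)$ be a finite Coxeter system, with geometric representation $V$ and set of reflections $T=\bigcup_{w\in W} wSw^{-1}$. For $w\in W$ let $V^w=\{x\in V : w(x)=x\}$; let $\ell_T(w)$ be the smallest $k$ such that $w$ is a product of $k$ elements of $T$; write $v\leq_T u$ if $\ell_T(v)+\ell_T(v^{-1}u)=\ell_T(u)$ (the absolute order); and let $P(w)$ be the parabolic closure of $w$, that is, the smallest subgroup containing $w$ of the form $x\langle I\rangle x^{-1}$ with $x\in W$ and $I\subseteq S$ (equivalently, the intersection of all such subgroups containing $w$). Let $u\in W$ be an involution, i.e. $u^2=1$ (the case $u=1$ is allowed), and let $v\in W$. Then the following are equivalent: 1. $v\leq_T u$; 2. $v^2=1$ and $v\in P(u)$; 3. $v^2=1$ and $V^u\subseteq V^v$. If any of these conditions holds, then $uv=vu$. -/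

import Mathlib

/-!
Fix an inner product on `V` invariant under the finite group `W`.

Parabolic subgroups are the stabilizers of vectors: every orbit contains a dominant vector, and as
`w α_i` is nonpositive whenever `w s_i` is shorter than `w`, the stabilizer of a dominant vector is
generated by simple reflections. Hence `v ∈ P(u)` says exactly that `V^u ⊆ V^v`.

The stabilizer of a vector `x ∈ V^w` is thus generated by reflections. For `w ≠ 1` and `x` outside
the finitely many proper subspaces `V^w ∩ V^g`, it provides a reflection `t` with `V^w ⊆ V^t`, and
then `V^w` is strictly smaller than `V^{tw}`. Induction gives Carter's lemma
`ℓ_T(w) = codim V^w`, so that counting dimensions turns `v ≤_T u` into `V^u ⊆ V^v` together with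
`V^v + V^{v⁻¹u} = V`.

If `u² = 1`, then `u` is the identity on `V^u` and `-1` on its orthogonal complement. When
`V^u ⊆ V^v`, the isometry `v` respects this decomposition and so commutes with `u`; the condition
`V^v + V^{v⁻¹u} = V` then says that `V` is the sum of `{x | v x = x}` and `{x | v x = u x}`, which
amounts to `v² = 1`.
-/

namespace CoxeterMatrix

variable {B : Type*} (M : CoxeterMatrix B)

/-- The canonical symmetric bilinear form on the real vector space with basis the simple roots
`α_i = Finsupp.single i 1`, given by `⟨α_i, α_j⟩ = - cos (π / m_{ij})`. In Mathlib the label `∞` is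
encoded as `0`, and then the value is `- cos 0 = -1`, as it should be. -/
noncomputable def cosForm : LinearMap.BilinForm ℝ (B →₀ ℝ) :=
  Finsupp.linearCombination ℝ fun i =>
    Finsupp.linearCombination ℝ fun j => -Real.cos (Real.pi / (M i j : ℝ))

theorem cosForm_single (i j : B) :
    M.cosForm (Finsupp.single i 1) (Finsupp.single j 1) = -Real.cos (Real.pi / (M i j : ℝ)) := by
  simp [cosForm]

theorem two_cosForm_self (i : B) :
    ((2 : ℝ) • M.cosForm (Finsupp.single i 1)) (Finsupp.single i 1) = 2 := by
  simp [cosForm_single]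

/-- The reflection `σ_i : x ↦ x - 2 ⟨α_i, x⟩ α_i` of the geometric representation. -/
noncomputable def geomReflection (i : B) : (B →₀ ℝ) ≃ₗ[ℝ] (B →₀ ℝ) :=
  Module.reflection (M.two_cosForm_self i)

theorem geomReflection_apply (i : B) (x : B →₀ ℝ) :
    M.geomReflection i x = x - (2 * M.cosForm (Finsupp.single i 1) x) • Finsupp.single i 1 := by
  simp [geomReflection, Module.reflection_apply]

/-- The reflections `σ_i` satisfy the defining relations of the Coxeter group. -/
theorem isLiftable_geomReflection : M.IsLiftable M.geomReflection := by
  intro i j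
  rcases eq_or_ne i j with rfl | hij
  · rw [M.diagonal, pow_one]
    ext1 x
    exact Module.involutive_reflection (M.two_cosForm_self i) x
  obtain hm | hm | hm : M i j = 0 ∨ M i j = 2 ∨ 3 ≤ M i j := by
    have := M.off_diagonal i j hij
    omega
  · rw [hm, pow_zero]
  · have h1 : M.cosForm (Finsupp.single i 1) (Finsupp.single j 1) = 0 := by
      simp [cosForm_single, hm]
    have h2 : M.cosForm (Finsupp.single j 1) (Finsupp.single i 1) = 0 := by
      simp [cosForm_single, M.symmetric j i, hm]
    have h3 : M.cosForm (Finsupp.single i 1) (Finsupp.single i 1) = 1 := by simp [cosForm_single]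
    have h4 : M.cosForm (Finsupp.single j 1) (Finsupp.single j 1) = 1 := by simp [cosForm_single]
    ext1 x
    rw [hm, pow_two]
    simp only [LinearEquiv.mul_apply, geomReflection_apply, map_sub, map_smul, smul_eq_mul,
      h1, h2, h3, h4, LinearEquiv.coe_one, id]
    module
  · set m := M i j with hmdef
    set θ : ℝ := 2 * Real.pi / m with hθ
    have hm0 : (0 : ℝ) < m := by
      have : 0 < m := by omega
      exact_mod_cast this
    have hm3 : (3 : ℝ) ≤ m := by exact_mod_cast hm
    have hmθ : (m : ℝ) * θ = 2 * Real.pi := by rw [hθ]; field_simp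
    have hsin : Real.sin θ ≠ 0 := by
      refine (Real.sin_pos_of_pos_of_lt_pi ?_ ?_).ne'
      · rw [hθ]; positivity
      · nlinarith [Real.pi_pos]
    have hU (n : ℤ) : (Polynomial.Chebyshev.S ℝ n).eval (2 * Real.cos θ) * Real.sin θ
        = Real.sin ((n + 1) * θ) := by
      rw [← Polynomial.Chebyshev.U_real_cos θ n, ← Polynomial.Chebyshev.S_comp_two_mul_X]
      simp
    have ht : 2 * Real.cos θ =
        ((2 : ℝ) • M.cosForm (Finsupp.single i 1)) (Finsupp.single j 1) *
          ((2 : ℝ) • M.cosForm (Finsupp.single j 1)) (Finsupp.single i 1) - 2 := by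
      have : θ = 2 * (Real.pi / m) := by rw [hθ]; ring
      rw [this, Real.cos_two_mul]
      simp only [LinearMap.smul_apply, cosForm_single, M.symmetric j i, smul_eq_mul, ← hmdef]
      ring
    ext1 x
    have key := Module.reflection_mul_reflection_pow_apply (M.two_cosForm_self i)
      (M.two_cosForm_self j) m x (2 * Real.cos θ) ht
    refine key.trans ?_
    rcases Nat.even_or_odd' m with ⟨k, hk | hk⟩
    · have e1 : ((m : ℤ) - 2) / 2 = k - 1 := by omega
      have e2 : ((m : ℤ) - 1) / 2 = k - 1 := by omega
      have h0 : (Polynomial.Chebyshev.S ℝ ((k : ℤ) - 1)).eval (2 * Real.cos θ) = 0 := by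
        have h := hU ((k : ℤ) - 1)
        have hk' : (k : ℝ) * θ = Real.pi := by
          have : (m : ℝ) = 2 * k := by exact_mod_cast hk
          rw [this] at hmθ
          linarith
        push_cast at h
        rw [sub_add_cancel, hk', Real.sin_pi] at h
        exact (mul_eq_zero.mp h).resolve_right hsin
      rw [e1, e2, h0]
      simp
    · have e1 : ((m : ℤ) - 2) / 2 = k - 1 := by omega
      have e2 : ((m : ℤ) - 1) / 2 = k := by omega
      have e3 : ((m : ℤ) - 3) / 2 = k - 1 := by omega
      have e4 : (m : ℤ) / 2 = k := by omega
      have h0 : (Polynomial.Chebyshev.S ℝ (k : ℤ)).eval (2 * Real.cos θ) +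
          (Polynomial.Chebyshev.S ℝ ((k : ℤ) - 1)).eval (2 * Real.cos θ) = 0 := by
        have h := hU ((k : ℤ) - 1)
        have h' := hU (k : ℤ)
        have hk' : ((k : ℝ) + 1) * θ = 2 * Real.pi - k * θ := by
          have : (m : ℝ) = 2 * k + 1 := by exact_mod_cast hk
          rw [this] at hmθ
          linarith
        push_cast at h h'
        rw [sub_add_cancel] at h
        rw [hk', Real.sin_two_pi_sub] at h'
        refine (mul_eq_zero.mp ?_).resolve_right hsin
        rw [add_mul, h, h']
        ring
      rw [e1, e2, e3, e4, h0]
      simp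

end CoxeterMatrix

namespace CoxeterSystem

variable {B W : Type*} [Group W] {M : CoxeterMatrix B} (cs : CoxeterSystem M W)

/-- The geometric representation of a Coxeter system, on the real vector space `V` with basis
the simple roots; the simple reflection `s_i` acts as `σ_i`. -/
noncomputable def geomRep : W →* ((B →₀ ℝ) ≃ₗ[ℝ] (B →₀ ℝ)) :=
  cs.lift ⟨M.geomReflection, M.isLiftable_geomReflection⟩

theorem geomRep_simple (i : B) : cs.geomRep (cs.simple i) = M.geomReflection i :=
  cs.lift_apply_simple M.isLiftable_geomReflection i

/-- The fixed space `V^w` of `w` in the geometric representation. -/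
def fixedSpace (w : W) : Submodule ℝ (B →₀ ℝ) where
  carrier := {x | cs.geomRep w x = x}
  add_mem' {x y} hx hy := by
    change cs.geomRep w (x + y) = x + y
    rw [map_add, hx, hy]
  zero_mem' := map_zero (cs.geomRep w)
  smul_mem' c x hx := by
    change cs.geomRep w (c • x) = c • x
    rw [map_smul, hx]

/-- The reflection length `ℓ_T(w)`: the least `k` such that `w` is a product of `k` reflections. -/
noncomputable def reflectionLength (w : W) : ℕ :=
  sInf {k | ∃ l : List W, (∀ t ∈ l, cs.IsReflection t) ∧ l.prod = w ∧ l.length = k}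

/-- The minimum in the definition of the reflection length is attained. -/
theorem exists_list_length_eq_reflectionLength (w : W) :
    ∃ l : List W, (∀ t ∈ l, cs.IsReflection t) ∧ l.prod = w ∧
      l.length = cs.reflectionLength w := by
  refine Nat.sInf_mem (s := {k | ∃ l : List W, (∀ t ∈ l, cs.IsReflection t) ∧ l.prod = w ∧
    l.length = k}) ?_
  obtain ⟨ω, rfl⟩ := cs.wordProd_surjective w
  refine ⟨_, ω.map cs.simple, ?_, rfl, rfl⟩
  intro t ht
  obtain ⟨i, -, rfl⟩ := List.mem_map.mp ht
  exact cs.isReflection_simple i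

/-- The absolute order `v ≤_T u` on `W`. -/
def AbsLE (v u : W) : Prop :=
  cs.reflectionLength v + cs.reflectionLength (v⁻¹ * u) = cs.reflectionLength u

/-- The standard parabolic subgroup `W_I` generated by the simple reflections in `I`. -/
def standardParabolic (I : Set B) : Subgroup W :=
  Subgroup.closure (cs.simple '' I)

/-- Parabolic subgroups: the conjugates `w W_I w⁻¹` of the standard parabolic subgroups. -/
def IsParabolic (P : Subgroup W) : Prop :=
  ∃ (w : W) (I : Set B), P = (cs.standardParabolic I).map (MulAut.conj w).toMonoidHom

/-- The parabolic closure `P(w)`: the intersection of all parabolic subgroups containing `w`. -/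
def parabolicClosure (w : W) : Subgroup W :=
  sInf {P | cs.IsParabolic P ∧ w ∈ P}

/-- If there is a smallest parabolic subgroup containing `w`, it is the parabolic closure. -/
theorem parabolicClosure_eq_of_isLeast {w : W} {P : Subgroup W}
    (h : IsLeast {P | cs.IsParabolic P ∧ w ∈ P} P) : cs.parabolicClosure w = P :=
  h.csInf_eq

end CoxeterSystem

namespace AbsoluteOrder

open LinearMap (fixedSubmodule mem_fixedSubmodule_iff)

section Isometries

variable {K V : Type*} [Field K] [AddCommGroup V] [Module K V] {β : LinearMap.BilinForm K V}
  {f g t u v : V ≃ₗ[K] V}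

/-- The moved space `im (f - 1)` of a linear automorphism. For an isometry it is the orthogonal
complement of the fixed space, which is how inclusions of fixed spaces are exploited. -/
def movedSubmodule (f : V ≃ₗ[K] V) : Submodule K V :=
  LinearMap.range (f.toLinearMap - LinearMap.id)

theorem mem_movedSubmodule_iff {x : V} : x ∈ movedSubmodule f ↔ ∃ y, f y - y = x := Iff.rfl

theorem orthogonal_movedSubmodule (hβ : β.Nondegenerate) (hf : β.IsOrthogonal f) :
    β.orthogonal (movedSubmodule f) = f.fixedSubmodule := by
  ext y
  have hmoved (x : V) : β (f x - x) y = β (f x) (y - f y) := by simp [hf x y]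
  rw [LinearMap.BilinForm.mem_orthogonal_iff, mem_fixedSubmodule_iff]
  constructor
  · intro h
    refine (sub_eq_zero.mp (hβ.2 _ fun z => ?_)).symm
    obtain ⟨x, rfl⟩ := f.surjective z
    exact (hmoved x).symm.trans (h _ ⟨x, rfl⟩)
  · rintro hy _ ⟨x, rfl⟩
    have hy' : y - f y = 0 := sub_eq_zero.mpr hy.symm
    exact (hmoved x).trans (by rw [hy', map_zero])

theorem orthogonal_fixedSubmodule [FiniteDimensional K V] (hβ : β.Nondegenerate)
    (hrefl : β.IsRefl) (hf : β.IsOrthogonal f) :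
    β.orthogonal f.fixedSubmodule = movedSubmodule f := by
  rw [← orthogonal_movedSubmodule hβ hf, LinearMap.BilinForm.orthogonal_orthogonal hβ hrefl]

theorem movedSubmodule_le_of_fixedSubmodule_le [FiniteDimensional K V] (hβ : β.Nondegenerate)
    (hrefl : β.IsRefl) (hf : β.IsOrthogonal f) (hg : β.IsOrthogonal g)
    (hfg : f.fixedSubmodule ≤ g.fixedSubmodule) : movedSubmodule g ≤ movedSubmodule f := by
  rw [← orthogonal_fixedSubmodule hβ hrefl hf, ← orthogonal_fixedSubmodule hβ hrefl hg]
  exact LinearMap.BilinForm.orthogonal_le hfg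

theorem apply_apply_of_sq_eq_one (hu : u ^ 2 = 1) (x : V) : u (u x) = x := by
  rw [← LinearEquiv.mul_apply, ← pow_two, hu, LinearEquiv.coe_one, id]

theorem apply_involution_of_fixedSubmodule_le (hu : u ^ 2 = 1)
    (huv : u.fixedSubmodule ≤ v.fixedSubmodule) (x : V) : v (u x) = x + u x - v x := by
  have hfix : x + u x ∈ u.fixedSubmodule := by
    simp [apply_apply_of_sq_eq_one hu, add_comm]
  have hv : v x + v (u x) = x + u x := by simpa using huv hfix
  rw [← hv, add_sub_cancel_left]

theorem involution_apply_of_fixedSubmodule_le [FiniteDimensional K V] (hβ : β.Nondegenerate)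
    (hrefl : β.IsRefl) (hu_isom : β.IsOrthogonal u) (hv_isom : β.IsOrthogonal v)
    (hu : u ^ 2 = 1) (huv : u.fixedSubmodule ≤ v.fixedSubmodule) (x : V) :
    u (v x) = x + u x - v x := by
  obtain ⟨y, hy⟩ := mem_movedSubmodule_iff.mp <|
    movedSubmodule_le_of_fixedSubmodule_le hβ hrefl hu_isom hv_isom huv ⟨x, rfl⟩
  have hvx : v x = x + (u y - y) := eq_add_of_sub_eq' hy.symm
  rw [hvx, map_add, map_sub, apply_apply_of_sq_eq_one hu]
  abel

theorem commute_of_fixedSubmodule_le [FiniteDimensional K V] (hβ : β.Nondegenerate)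
    (hrefl : β.IsRefl) (hu_isom : β.IsOrthogonal u) (hv_isom : β.IsOrthogonal v)
    (hu : u ^ 2 = 1) (huv : u.fixedSubmodule ≤ v.fixedSubmodule) : Commute u v :=
  LinearEquiv.ext fun x =>
    (involution_apply_of_fixedSubmodule_le hβ hrefl hu_isom hv_isom hu huv x).trans
      (apply_involution_of_fixedSubmodule_le hu huv x).symm

theorem mem_fixedSubmodule_inv_mul_iff {x : V} :
    x ∈ (v⁻¹ * u).fixedSubmodule ↔ u x = v x :=
  LinearEquiv.symm_apply_eq v

theorem sq_eq_one_iff_fixedSubmodule_sup_eq_top [NeZero (2 : K)] (hu : u ^ 2 = 1)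
    (huv : u.fixedSubmodule ≤ v.fixedSubmodule) (hcomm : Commute u v) :
    v ^ 2 = 1 ↔ v.fixedSubmodule ⊔ (v⁻¹ * u).fixedSubmodule = ⊤ := by
  have hvu := apply_involution_of_fixedSubmodule_le hu huv
  constructor
  · intro hv
    have hvv := apply_apply_of_sq_eq_one hv
    refine eq_top_iff.mpr fun x _ => ?_
    have hx : x = (2⁻¹ : K) • (x + v x) + (2⁻¹ : K) • (x - v x) := by
      rw [← smul_add, add_add_sub_cancel, ← two_smul K x, inv_smul_smul₀ two_ne_zero]
    have hadd : x + v x ∈ v.fixedSubmodule := by simp [hvv, add_comm]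
    have hsub : x - v x ∈ (v⁻¹ * u).fixedSubmodule := by
      have huvx : u (v x) = x + u x - v x := (DFunLike.congr_fun hcomm.eq x).trans (hvu x)
      rw [mem_fixedSubmodule_inv_mul_iff, map_sub, map_sub, hvv, huvx]
      abel
    rw [hx]
    exact Submodule.add_mem_sup (Submodule.smul_mem _ _ hadd) (Submodule.smul_mem _ _ hsub)
  · intro hsup
    refine LinearEquiv.ext fun x => ?_
    obtain ⟨y, hy, z, hz, rfl⟩ := Submodule.mem_sup.mp (hsup ▸ Submodule.mem_top (x := x))
    have hvy : v y = y := hy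
    have huz : u z = v z := mem_fixedSubmodule_inv_mul_iff.mp hz
    have hvvz : v (v z) = z := by rw [← huz, hvu, huz, add_sub_cancel_right]
    rw [pow_two, LinearEquiv.mul_apply, map_add, map_add, hvy, hvy, hvvz, LinearEquiv.coe_one,
      id]

theorem fixedSubmodule_lt_fixedSubmodule_mul [FiniteDimensional K V] [NeZero (2 : K)]
    (hβ : β.Nondegenerate) (hsymm : β.IsSymm) (hf : β.IsOrthogonal f) {r : V} (hr : r ≠ 0)
    (htr : t r = -r) (ht : ∀ x, t x = x ↔ β r x = 0)
    (hft : f.fixedSubmodule ≤ t.fixedSubmodule) :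
    f.fixedSubmodule < (t * f).fixedSubmodule := by
  obtain ⟨y, hy⟩ : r ∈ movedSubmodule f := by
    rw [← orthogonal_fixedSubmodule hβ hsymm.isRefl hf]
    exact fun x hx => (hsymm.eq x r).trans ((ht x).mp (hft hx))
  have hfy : f y = y + r := eq_add_of_sub_eq' hy
  have horth : β r (y + y + r) = 0 := by
    have h := hf y y
    rw [hfy] at h
    simp only [map_add, LinearMap.add_apply] at h ⊢
    linear_combination h + hsymm.eq r y
  have hty : t (y + r) = y := by
    refine smul_right_injective V (two_ne_zero : (2 : K) ≠ 0) ?_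
    calc (2 : K) • t (y + r) = t (y + y + r) + t r := by
          rw [← map_smul, ← map_add, two_smul]
          congr 1
          abel
      _ = (2 : K) • y := by
          rw [(ht _).mpr horth, htr, two_smul, add_neg_cancel_right]
  refine lt_of_le_of_ne (fun x hx => ?_) fun h => hr ?_
  · exact LinearMap.fixedSubmodule_inf_fixedSubmodule_le_comp _ _ ⟨hft hx, hx⟩
  · have hmem : y ∈ f.fixedSubmodule := h ▸ (congrArg t hfy).trans hty
    simpa [hfy] using hmem

end Isometries

section InvariantInner

variable {G V : Type*} [Group G] [AddCommGroup V] [Module ℝ V] {ρ : G →* V ≃ₗ[ℝ] V}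
  {β : LinearMap.BilinForm ℝ V}

/-- An inner product on `V` for which every `ρ g` is an isometry. -/
structure IsInvariantInner (ρ : G →* V ≃ₗ[ℝ] V) (β : LinearMap.BilinForm ℝ V) : Prop where
  isSymm : β.IsSymm
  pos : ∀ x, x ≠ 0 → 0 < β x x
  isOrthogonal : ∀ g, β.IsOrthogonal (ρ g)

theorem exists_isInvariantInner [Finite G] [FiniteDimensional ℝ V] (ρ : G →* V ≃ₗ[ℝ] V) :
    ∃ β, IsInvariantInner ρ β := by
  have := Fintype.ofFinite G
  let b := Module.finBasis ℝ V
  let β : LinearMap.BilinForm ℝ V := ∑ g, ∑ k, LinearMap.BilinForm.linMulLin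
    (b.coord k ∘ₗ (ρ g).toLinearMap) (b.coord k ∘ₗ (ρ g).toLinearMap)
  have hβ (x y : V) : β x y = ∑ g, ∑ k, b.coord k (ρ g x) * b.coord k (ρ g y) := by
    simp [β, LinearMap.sum_apply]
  refine ⟨β, ⟨fun x y => ?_⟩, fun x hx => ?_, fun h x y => ?_⟩
  · simp only [hβ, mul_comm]
  · obtain ⟨k, hk⟩ : ∃ k, b.coord k x ≠ 0 := by
      by_contra! h
      exact hx (b.forall_coord_eq_zero_iff.mp h)
    rw [hβ]
    refine Finset.sum_pos' (fun g _ => Finset.sum_nonneg fun k _ => mul_self_nonneg _)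
      ⟨1, Finset.mem_univ _, Finset.sum_pos' (fun k _ => mul_self_nonneg _)
        ⟨k, Finset.mem_univ _, ?_⟩⟩
    simpa using mul_self_pos.mpr hk
  · simp only [hβ, ← LinearEquiv.mul_apply, ← map_mul]
    exact Fintype.sum_equiv (Equiv.mulRight h) _ _ fun _ => rfl

namespace IsInvariantInner

theorem nondegenerate (hβ : IsInvariantInner ρ β) : β.Nondegenerate :=
  (LinearMap.IsRefl.nondegenerate_iff_separatingLeft hβ.isSymm.isRefl).mpr fun x hx => by
    by_contra hne
    exact (hβ.pos x hne).ne' (hx x)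

theorem apply_left (hβ : IsInvariantInner ρ β) (g : G) (x y : V) :
    β (ρ g x) y = β x (ρ g⁻¹ y) := by
  rw [← hβ.isOrthogonal g x, ← LinearEquiv.mul_apply, ← map_mul, mul_inv_cancel, map_one,
    LinearEquiv.coe_one, id]

end IsInvariantInner

end InvariantInner

theorem exists_mem_forall_mem_imp_le {ι K V : Type*} [Finite ι] [Field K] [Infinite K]
    [AddCommGroup V] [Module K V] (U : Submodule K V) (p : ι → Submodule K V) :
    ∃ x ∈ U, ∀ i, x ∈ p i → U ≤ p i := by
  by_contra! h
  have hcover : ⋃ i : {i // ¬ U ≤ p i}, ((p i).comap U.subtype : Set U) = Set.univ :=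
    Set.eq_univ_of_forall fun x => by
      obtain ⟨i, hxi, hi⟩ := h x x.2
      exact Set.mem_iUnion.mpr ⟨⟨i, hi⟩, hxi⟩
  obtain ⟨i, hi⟩ := Subspace.exists_eq_top_of_iUnion_eq_univ hcover
  exact i.2 (Submodule.comap_subtype_eq_top.mp hi)

section DihedralCoefficients

open Polynomial.Chebyshev (U)

/-- The coefficients `sin (p π / m) / sin (π / m)` of the roots of the dihedral group of order
`2m`, encoded as values of Chebyshev polynomials so that the label `m = 0`, standing for `∞`, gets
the limit value `p`. -/
noncomputable def dihedralCoeff (m p : ℕ) : ℝ :=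
  (U ℝ (p - 1 : ℤ)).eval (Real.cos (Real.pi / m))

theorem dihedralCoeff_zero (m : ℕ) : dihedralCoeff m 0 = 0 := by simp [dihedralCoeff]

theorem dihedralCoeff_one (m : ℕ) : dihedralCoeff m 1 = 1 := by simp [dihedralCoeff]

theorem dihedralCoeff_add_two (m p : ℕ) : dihedralCoeff m (p + 2) =
    2 * Real.cos (Real.pi / m) * dihedralCoeff m (p + 1) - dihedralCoeff m p := by
  have h := congrArg (Polynomial.eval (Real.cos (Real.pi / m)))
    (Polynomial.Chebyshev.U_add_one ℝ (p : ℤ))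
  simp only [dihedralCoeff, Nat.cast_add, Nat.cast_one, Nat.cast_ofNat, add_sub_cancel_right]
  rw [show (p : ℤ) + 2 - 1 = p + 1 by ring, h]
  simp

theorem dihedralCoeff_nonneg {m p : ℕ} (hm : m ≠ 1) (hp : m ≠ 0 → p ≤ m) :
    0 ≤ dihedralCoeff m p := by
  rcases eq_or_ne m 0 with rfl | hm0
  · simp [dihedralCoeff]
  have hm2 : (2 : ℝ) ≤ m := by exact_mod_cast (show 2 ≤ m by omega)
  have hsin : 0 < Real.sin (Real.pi / m) :=
    Real.sin_pos_of_pos_of_lt_pi (by positivity)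
      (div_lt_self Real.pi_pos (one_lt_two.trans_le hm2))
  refine nonneg_of_mul_nonneg_left ?_ hsin
  rw [dihedralCoeff, Polynomial.Chebyshev.U_real_cos]
  have hle : (p : ℝ) * (Real.pi / m) ≤ Real.pi := by
    rw [← mul_div_assoc, div_le_iff₀ (by positivity), mul_comm]
    exact mul_le_mul_of_nonneg_left (by exact_mod_cast hp hm0) Real.pi_pos.le
  have hcast : ((p - 1 : ℤ) : ℝ) + 1 = p := by push_cast; ring
  rw [hcast]
  exact Real.sin_nonneg_of_nonneg_of_le_pi (by positivity) hle

end DihedralCoefficients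

open CoxeterSystem (alternatingWord)

section Roots

theorem geomReflection_single_self {B : Type*} (M : CoxeterMatrix B) (i : B) :
    M.geomReflection i (Finsupp.single i 1) = -Finsupp.single i 1 := by
  rw [M.geomReflection_apply, M.cosForm_single, M.diagonal, Nat.cast_one, div_one, Real.cos_pi]
  module

theorem geomReflection_single {B : Type*} (M : CoxeterMatrix B) (i j : B) :
    M.geomReflection i (Finsupp.single j 1) =
      Finsupp.single j 1 + (2 * Real.cos (Real.pi / M i j)) • Finsupp.single i 1 := by
  rw [M.geomReflection_apply, M.cosForm_single]
  module

variable {B W : Type*} [Group W] {M : CoxeterMatrix B} (cs : CoxeterSystem M W)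

/-- The root `w α_i` of the geometric representation. -/
noncomputable def root (w : W) (i : B) : B →₀ ℝ := cs.geomRep w (Finsupp.single i 1)

theorem root_one (i : B) : root cs 1 i = Finsupp.single i 1 := by
  rw [root, map_one, LinearEquiv.coe_one, id]

theorem geomRep_root (v w : W) (i : B) : cs.geomRep v (root cs w i) = root cs (v * w) i := by
  rw [root, root, map_mul, LinearEquiv.mul_apply]

theorem root_mul_simple_self (w : W) (i : B) : root cs (w * cs.simple i) i = -root cs w i := by
  rw [← geomRep_root, root, cs.geomRep_simple, geomReflection_single_self, map_neg, root]

theorem root_wordProd_alternatingWord (i j : B) (p : ℕ) :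
    root cs (cs.wordProd (alternatingWord i j p)) i =
      dihedralCoeff (M i j) p • Finsupp.single (if Even p then j else i) 1 +
      dihedralCoeff (M i j) (p + 1) • Finsupp.single (if Even p then i else j) 1 := by
  induction p with
  | zero => simp [alternatingWord, root_one, dihedralCoeff_zero, dihedralCoeff_one]
  | succ p ih =>
    rw [CoxeterSystem.alternatingWord_succ', cs.wordProd_cons, ← geomRep_root, ih,
      dihedralCoeff_add_two, cs.geomRep_simple, map_add, map_smul, map_smul]
    by_cases hp : Even p
    · simp only [hp, Nat.even_add_one, if_true, not_true, if_false, geomReflection_single_self,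
        geomReflection_single, M.symmetric j i]
      module
    · simp only [hp, Nat.even_add_one, not_false_iff, if_true, if_false,
        geomReflection_single_self, geomReflection_single]
      module

theorem not_isRightDescent_of_length_mul_wordProd_cons {v : W} {k : B} {ω : List B}
    (h : cs.length (v * cs.wordProd (k :: ω)) = cs.length v + (k :: ω).length) :
    ¬ cs.IsRightDescent v k := by
  have hmul := cs.length_mul_le (v * cs.simple k) (cs.wordProd ω)
  have hword := cs.length_wordProd_le ω
  rw [mul_assoc, ← cs.wordProd_cons, h, List.length_cons] at hmul
  rw [CoxeterSystem.IsRightDescent]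
  omega

theorem exists_eq_mul_wordProd_alternatingWord {w : W} {i : B} (hi : ¬ cs.IsRightDescent w i)
    (j : B) : ∃ v p, w = v * cs.wordProd (alternatingWord i j p) ∧
      cs.length w = cs.length v + p ∧ ¬ cs.IsRightDescent v i ∧ ¬ cs.IsRightDescent v j := by
  let IsSuffix (p : ℕ) : Prop :=
    ∃ v, w = v * cs.wordProd (alternatingWord i j p) ∧ cs.length w = cs.length v + p
  have hzero : IsSuffix 0 := ⟨w, by simp [alternatingWord]⟩
  obtain ⟨p, ⟨v, hw, hlen⟩, hmax⟩ : ∃ p, IsSuffix p ∧ ¬ IsSuffix (p + 1) := by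
    by_contra! hsucc
    have hall (p : ℕ) : IsSuffix p := Nat.rec hzero hsucc p
    obtain ⟨v, -, hlen⟩ := hall (cs.length w + 1)
    omega
  have hnext : ¬ cs.IsRightDescent v (if Even p then j else i) := by
    intro h
    rw [cs.isRightDescent_iff] at h
    refine hmax ⟨v * cs.simple (if Even p then j else i), ?_, by omega⟩
    rw [CoxeterSystem.alternatingWord_succ', cs.wordProd_cons, ← mul_assoc,
      cs.simple_mul_simple_cancel_right, hw]
  have hprev : ¬ cs.IsRightDescent v (if Even p then i else j) := by
    rcases p with _ | k
    · simpa [hw, alternatingWord] using hi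
    have hhead : (if Even (k + 1) then i else j) = if Even k then j else i := by
      simp only [Nat.even_add_one, ite_not]
    rw [hhead]
    rw [hw, CoxeterSystem.alternatingWord_succ'] at hlen
    refine not_isRightDescent_of_length_mul_wordProd_cons cs (hlen.trans ?_)
    rw [List.length_cons, CoxeterSystem.length_alternatingWord]
  refine ⟨v, p, hw, hlen, ?_⟩
  split_ifs at hnext hprev
  exacts [⟨hprev, hnext⟩, ⟨hnext, hprev⟩]

theorem lt_of_length_mul_wordProd_alternatingWord {v : W} {i j : B} {p : ℕ}
    (hlen : cs.length (v * cs.wordProd (alternatingWord i j p)) = cs.length v + p)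
    (hi : ¬ cs.IsRightDescent (v * cs.wordProd (alternatingWord i j p)) i) (hM : M i j ≠ 0) :
    p < M i j := by
  rw [cs.not_isRightDescent_iff, hlen, mul_assoc, ← cs.wordProd_concat,
    ← CoxeterSystem.alternatingWord_succ j i] at hi
  have hred : cs.IsReduced (alternatingWord j i (p + 1)) := by
    have hge := cs.length_mul_le v (cs.wordProd (alternatingWord j i (p + 1)))
    have hle := cs.length_wordProd_le (alternatingWord j i (p + 1))
    rw [CoxeterSystem.length_alternatingWord] at hle
    rw [CoxeterSystem.IsReduced, CoxeterSystem.length_alternatingWord]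
    omega
  by_contra! hlt
  rw [M.symmetric i j] at hM hlt
  exact cs.not_isReduced_alternatingWord j i hM (Nat.lt_succ_of_le hlt) hred

theorem root_nonneg {w : W} {i : B} (hi : ¬ cs.IsRightDescent w i) : 0 ≤ root cs w i := by
  induction hn : cs.length w using Nat.strong_induction_on generalizing w i with
  | _ n ih =>
  subst hn
  rcases eq_or_ne w 1 with rfl | hw
  · rw [root_one]
    exact Finsupp.single_nonneg.mpr zero_le_one
  obtain ⟨j, hj⟩ := cs.exists_rightDescent_of_ne_one hw
  have hij : i ≠ j := fun h => hi (h ▸ hj)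
  obtain ⟨v, p, rfl, hlen, hvi, hvj⟩ := exists_eq_mul_wordProd_alternatingWord cs hi j
  have hp : p ≠ 0 := by
    rintro rfl
    exact hvj (by simpa [alternatingWord] using hj)
  have hpM := lt_of_length_mul_wordProd_alternatingWord cs hlen hi
  have hvroot {k : B} (hk : ¬ cs.IsRightDescent v k) : 0 ≤ root cs v k :=
    ih _ (by omega) hk rfl
  rw [← geomRep_root, root_wordProd_alternatingWord, map_add, map_smul, map_smul]
  refine add_nonneg
    (smul_nonneg (dihedralCoeff_nonneg (M.off_diagonal i j hij) fun h => (hpM h).le)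
      (hvroot ?_))
    (smul_nonneg (dihedralCoeff_nonneg (M.off_diagonal i j hij) hpM) (hvroot ?_))
  all_goals split_ifs <;> assumption

theorem root_nonpos {w : W} {i : B} (hi : cs.IsRightDescent w i) : root cs w i ≤ 0 := by
  rw [cs.isRightDescent_iff_not_isRightDescent_mul] at hi
  rw [← neg_nonneg, ← root_mul_simple_self]
  exact root_nonneg cs hi

theorem geomRep_injective : Function.Injective cs.geomRep := by
  rw [injective_iff_map_eq_one]
  intro w hw
  by_contra hne
  obtain ⟨i, hi⟩ := cs.exists_rightDescent_of_ne_one hne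
  have hle : (Finsupp.single i 1 : B →₀ ℝ) ≤ 0 := by
    simpa only [root, hw, LinearEquiv.coe_one, id] using root_nonpos cs hi
  exact absurd (hle i) (by simp)

theorem simple_injective : Function.Injective cs.simple := by
  intro i j hij
  by_contra hne
  have h : -Finsupp.single i (1 : ℝ) =
      Finsupp.single i 1 + (2 * Real.cos (Real.pi / M j i)) • Finsupp.single j 1 := by
    rw [← geomReflection_single_self M, ← cs.geomRep_simple, hij, cs.geomRep_simple,
      geomReflection_single]
  have hcoeff := DFunLike.congr_fun h i
  simp [Ne.symm hne] at hcoeff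
  linarith

include cs in
theorem finite_index [Finite W] : Finite B := Finite.of_injective cs.simple (simple_injective cs)

end Roots

section PointStabilizers

variable {B W : Type*} [Group W] {M : CoxeterMatrix B} (cs : CoxeterSystem M W)
  {β : LinearMap.BilinForm ℝ (B →₀ ℝ)}

/-- The subgroup of the elements fixing the vector `x` of the geometric representation. For finite
`W`, these subgroups are exactly the parabolic ones. -/
noncomputable def pointStabilizer (x : B →₀ ℝ) : Subgroup W :=
  (MulAction.stabilizer ((B →₀ ℝ) ≃ₗ[ℝ] (B →₀ ℝ)) x).comap cs.geomRep

theorem mem_pointStabilizer_iff {w : W} {x : B →₀ ℝ} :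
    w ∈ pointStabilizer cs x ↔ cs.geomRep w x = x := Iff.rfl

theorem pointStabilizer_geomRep (w : W) (x : B →₀ ℝ) :
    pointStabilizer cs (cs.geomRep w x) =
      (pointStabilizer cs x).map (MulAut.conj w).toMonoidHom := by
  ext g
  rw [Subgroup.mem_map_equiv, mem_pointStabilizer_iff, mem_pointStabilizer_iff,
    MulAut.conj_symm_apply, map_mul, map_mul, map_inv, LinearEquiv.mul_apply,
    LinearEquiv.mul_apply]
  exact (LinearEquiv.symm_apply_eq _).symm

/-- The dominant vectors for an inner product `β`: those having nonnegative inner product with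
every simple root. -/
def IsDominant (β : LinearMap.BilinForm ℝ (B →₀ ℝ)) (x : B →₀ ℝ) : Prop :=
  ∀ i, 0 ≤ β x (Finsupp.single i 1)

theorem IsDominant.apply_nonneg {x y : B →₀ ℝ} (hx : IsDominant β x) (hy : 0 ≤ y) :
    0 ≤ β x y := by
  have hβy : β x y = Finsupp.linearCombination ℝ (fun i => β x (Finsupp.single i 1)) y := by
    refine DFunLike.congr_fun (Finsupp.lhom_ext' fun i => LinearMap.ext_ring ?_) y
    simp
  rw [hβy, Finsupp.linearCombination_apply]
  exact Finset.sum_nonneg fun i _ => mul_nonneg (hy i) (hx i)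

theorem exists_isDominant_setOf_eq_zero [Finite B] (hβ : β.Nondegenerate) (I : Set B) :
    ∃ x, IsDominant β x ∧ {i | β x (Finsupp.single i 1) = 0} = I := by
  classical
  let f : Module.Dual ℝ (B →₀ ℝ) := Finsupp.linearCombination ℝ fun i => if i ∈ I then 0 else 1
  have hf (i : B) : β ((β.toDual hβ).symm f) (Finsupp.single i 1) = if i ∈ I then 0 else 1 := by
    rw [LinearMap.BilinForm.apply_toDual_symm_apply, Finsupp.linearCombination_single, one_smul]
  refine ⟨(β.toDual hβ).symm f, fun i => ?_, Set.ext fun i => ?_⟩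
  · rw [hf]
    split_ifs <;> norm_num
  · rw [Set.mem_ofPred_eq, hf, ite_eq_left_iff, imp_iff_not_or, not_not,
      or_iff_left one_ne_zero]

section InvariantInner

variable {cs} (hβ : IsInvariantInner cs.geomRep β)
include hβ

theorem geomRep_simple_apply (i : B) (x : B →₀ ℝ) :
    cs.geomRep (cs.simple i) x =
      x - (2 * β x (Finsupp.single i 1) / β (Finsupp.single i 1) (Finsupp.single i 1)) •
        Finsupp.single i 1 := by
  have hpos := hβ.pos (Finsupp.single i 1) (by simp)
  have hisom := hβ.isOrthogonal (cs.simple i) x (Finsupp.single i 1)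
  rw [cs.geomRep_simple, geomReflection_single_self, M.geomReflection_apply] at hisom
  rw [cs.geomRep_simple, M.geomReflection_apply]
  congr 2
  rw [eq_div_iff hpos.ne']
  simp only [map_neg, map_sub, map_smul, LinearMap.sub_apply, LinearMap.smul_apply,
    smul_eq_mul] at hisom
  linear_combination hisom

theorem geomRep_simple_apply_eq_self_iff (i : B) (x : B →₀ ℝ) :
    cs.geomRep (cs.simple i) x = x ↔ β x (Finsupp.single i 1) = 0 := by
  have hpos := hβ.pos (Finsupp.single i 1) (by simp)
  rw [geomRep_simple_apply hβ, sub_eq_self, smul_eq_zero]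
  simp [hpos.ne']

theorem apply_single_eq_zero_of_isRightDescent {x : B →₀ ℝ} (hx : IsDominant β x) {w : W}
    (hw : w ∈ pointStabilizer cs x) {i : B} (hi : cs.IsRightDescent w i) :
    β x (Finsupp.single i 1) = 0 := by
  refine le_antisymm ?_ (hx i)
  have hroot : β x (root cs w i) = β x (Finsupp.single i 1) := by
    conv_lhs => rw [← (mem_pointStabilizer_iff cs).mp hw]
    exact hβ.isOrthogonal w _ _
  have hneg := hx.apply_nonneg (neg_nonneg.mpr (root_nonpos cs hi))
  rwa [map_neg, neg_nonneg, hroot] at hneg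

theorem IsDominant.pointStabilizer_eq {x : B →₀ ℝ} (hx : IsDominant β x) :
    pointStabilizer cs x = cs.standardParabolic {i | β x (Finsupp.single i 1) = 0} := by
  refine le_antisymm (fun w hw => ?_) ?_
  · induction hn : cs.length w using Nat.strong_induction_on generalizing w with
    | _ n ih =>
    subst hn
    rcases eq_or_ne w 1 with rfl | hne
    · exact one_mem _
    obtain ⟨i, hi⟩ := cs.exists_rightDescent_of_ne_one hne
    have hzero := apply_single_eq_zero_of_isRightDescent hβ hx hw hi
    have hsimple : cs.simple i ∈ pointStabilizer cs x :=
      (geomRep_simple_apply_eq_self_iff hβ i x).mpr hzero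
    rw [← cs.simple_mul_simple_cancel_right (w := w) i]
    exact mul_mem (ih _ hi _ (mul_mem hw hsimple) rfl)
      (Subgroup.subset_closure ⟨i, hzero, rfl⟩)
  · rw [CoxeterSystem.standardParabolic, Subgroup.closure_le]
    rintro _ ⟨i, hi, rfl⟩
    exact (geomRep_simple_apply_eq_self_iff hβ i x).mpr hi

theorem exists_isDominant_geomRep [Finite W] (x : B →₀ ℝ) :
    ∃ w, IsDominant β (cs.geomRep w x) := by
  -- A vector of maximal coordinate sum in its orbit is dominant.
  let coordSum : (B →₀ ℝ) →ₗ[ℝ] ℝ := Finsupp.linearCombination ℝ fun _ => 1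
  have hsum (i : B) : coordSum (Finsupp.single i 1) = 1 := by simp [coordSum]
  obtain ⟨w, hw⟩ := Finite.exists_max fun w : W => coordSum (cs.geomRep w x)
  refine ⟨w, fun i => ?_⟩
  have hmax := hw (cs.simple i * w)
  rw [map_mul, LinearEquiv.mul_apply, geomRep_simple_apply hβ, map_sub, map_smul, hsum,
    smul_eq_mul, mul_one, sub_le_self_iff, le_div_iff₀ (hβ.pos _ (by simp)), zero_mul] at hmax
  exact nonneg_of_mul_nonneg_right hmax two_pos

end InvariantInner

theorem isParabolic_pointStabilizer [Finite W] (x : B →₀ ℝ) :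
    cs.IsParabolic (pointStabilizer cs x) := by
  have := finite_index cs
  obtain ⟨β, hβ⟩ := exists_isInvariantInner cs.geomRep
  obtain ⟨w, hw⟩ := exists_isDominant_geomRep hβ x
  refine ⟨w⁻¹, {i | β (cs.geomRep w x) (Finsupp.single i 1) = 0}, ?_⟩
  rw [← hw.pointStabilizer_eq hβ, ← pointStabilizer_geomRep, ← LinearEquiv.mul_apply, ← map_mul,
    inv_mul_cancel, map_one, LinearEquiv.coe_one, id]

theorem isParabolic_iff_exists_eq_pointStabilizer [Finite W] {P : Subgroup W} :
    cs.IsParabolic P ↔ ∃ x, P = pointStabilizer cs x := by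
  constructor
  · rintro ⟨w, I, rfl⟩
    have := finite_index cs
    obtain ⟨β, hβ⟩ := exists_isInvariantInner cs.geomRep
    obtain ⟨x, hx, rfl⟩ := exists_isDominant_setOf_eq_zero hβ.nondegenerate I
    exact ⟨cs.geomRep w x, by rw [pointStabilizer_geomRep, hx.pointStabilizer_eq hβ]⟩
  · rintro ⟨x, rfl⟩
    exact isParabolic_pointStabilizer cs x

theorem mem_parabolicClosure_iff [Finite W] {u v : W} :
    v ∈ cs.parabolicClosure u ↔ cs.fixedSpace u ≤ cs.fixedSpace v := by
  rw [CoxeterSystem.parabolicClosure, Subgroup.mem_sInf]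
  constructor
  · exact fun h x hx => h _ ⟨isParabolic_pointStabilizer cs x, hx⟩
  · rintro h P ⟨hP, hu⟩
    obtain ⟨x, rfl⟩ := (isParabolic_iff_exists_eq_pointStabilizer cs).mp hP
    exact h hu

end PointStabilizers

section ReflectionLength

variable {B W : Type*} [Group W] {M : CoxeterMatrix B} (cs : CoxeterSystem M W)

theorem exists_isReflection_mem_of_isParabolic {P : Subgroup W} (hP : cs.IsParabolic P)
    (hne : P ≠ ⊥) : ∃ t ∈ P, cs.IsReflection t := by
  obtain ⟨g, I, rfl⟩ := hP
  obtain ⟨i, hi⟩ : I.Nonempty := by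
    rw [Set.nonempty_iff_ne_empty]
    rintro rfl
    simp [CoxeterSystem.standardParabolic] at hne
  exact ⟨g * cs.simple i * g⁻¹, ⟨cs.simple i, Subgroup.subset_closure ⟨i, hi, rfl⟩, rfl⟩,
    (cs.isReflection_simple i).conj g⟩

theorem exists_isReflection_fixedSpace_le [Finite W] {w : W} (hw : w ≠ 1) :
    ∃ t, cs.IsReflection t ∧ cs.fixedSpace w ≤ cs.fixedSpace t := by
  obtain ⟨x, hxw, hx⟩ := exists_mem_forall_mem_imp_le (cs.fixedSpace w) cs.fixedSpace
  have hne : pointStabilizer cs x ≠ ⊥ := fun h =>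
    hw (Subgroup.mem_bot.mp (h ▸ (mem_pointStabilizer_iff cs).mpr hxw))
  obtain ⟨t, htx, ht⟩ :=
    exists_isReflection_mem_of_isParabolic cs (isParabolic_pointStabilizer cs x) hne
  exact ⟨t, ht, hx t htx⟩

variable {cs} in
theorem exists_root_of_isReflection {β : LinearMap.BilinForm ℝ (B →₀ ℝ)}
    (hβ : IsInvariantInner cs.geomRep β) {t : W} (ht : cs.IsReflection t) :
    ∃ r, r ≠ 0 ∧ cs.geomRep t r = -r ∧ ∀ x, cs.geomRep t x = x ↔ β r x = 0 := by
  obtain ⟨g, i, rfl⟩ := ht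
  refine ⟨root cs g i, ?_, ?_, fun x => ?_⟩
  · simp [root]
  · rw [geomRep_root, inv_mul_cancel_right, root_mul_simple_self]
  · rw [root, hβ.apply_left, ← hβ.isSymm.eq,
      ← geomRep_simple_apply_eq_self_iff hβ, mul_assoc, map_mul, map_mul, map_inv,
      LinearEquiv.mul_apply, LinearEquiv.mul_apply]
    exact (LinearEquiv.eq_symm_apply _).symm

theorem fixedSpace_eq_fixedSubmodule (w : W) :
    cs.fixedSpace w = (cs.geomRep w).toLinearMap.fixedSubmodule := rfl

theorem finrank_fixedSpace_add_one_of_isReflection [Finite W] {t : W}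
    (ht : cs.IsReflection t) :
    Module.finrank ℝ (cs.fixedSpace t) + 1 = Module.finrank ℝ (B →₀ ℝ) := by
  have := finite_index cs
  obtain ⟨β, hβ⟩ := exists_isInvariantInner cs.geomRep
  obtain ⟨r, hr, -, hfix⟩ := exists_root_of_isReflection hβ ht
  have hker : cs.fixedSpace t = LinearMap.ker (β r) := Submodule.ext hfix
  rw [hker]
  exact Module.Dual.finrank_ker_add_one_of_ne_zero fun h =>
    (hβ.pos r hr).ne' (DFunLike.congr_fun h r)

theorem exists_isReflection_fixedSpace_lt_fixedSpace_mul [Finite W] {w : W} (hw : w ≠ 1) :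
    ∃ t, cs.IsReflection t ∧ cs.fixedSpace w < cs.fixedSpace (t * w) := by
  have := finite_index cs
  obtain ⟨β, hβ⟩ := exists_isInvariantInner cs.geomRep
  obtain ⟨t, ht, hle⟩ := exists_isReflection_fixedSpace_le cs hw
  obtain ⟨r, hr, htr, hfix⟩ := exists_root_of_isReflection hβ ht
  refine ⟨t, ht, ?_⟩
  rw [fixedSpace_eq_fixedSubmodule, fixedSpace_eq_fixedSubmodule, map_mul]
  exact fixedSubmodule_lt_fixedSubmodule_mul hβ.nondegenerate hβ.isSymm (hβ.isOrthogonal w) hr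
    htr hfix hle

theorem fixedSpace_one : cs.fixedSpace 1 = ⊤ := by
  refine eq_top_iff.mpr fun x _ => ?_
  change cs.geomRep 1 x = x
  rw [map_one, LinearEquiv.coe_one, id]

theorem fixedSpace_inf_le_fixedSpace_mul (v w : W) :
    cs.fixedSpace v ⊓ cs.fixedSpace w ≤ cs.fixedSpace (v * w) := by
  rw [fixedSpace_eq_fixedSubmodule cs (v * w), map_mul]
  exact LinearMap.fixedSubmodule_inf_fixedSubmodule_le_comp _ _

theorem finrank_fixedSpace_add_finrank_fixedSpace_le [Finite B] (v w : W) :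
    Module.finrank ℝ (cs.fixedSpace v) + Module.finrank ℝ (cs.fixedSpace w) ≤
      Module.finrank ℝ (B →₀ ℝ) + Module.finrank ℝ (cs.fixedSpace (v * w)) := by
  rw [fixedSpace_eq_fixedSubmodule cs (v * w), map_mul]
  exact (LinearEquiv.finrank_fixedSubmodule_add_le _ _).trans
    (Nat.add_le_add_right (Submodule.finrank_le _) _)

theorem finrank_le_finrank_fixedSpace_prod_add_length [Finite W] {l : List W}
    (hl : ∀ t ∈ l, cs.IsReflection t) :
    Module.finrank ℝ (B →₀ ℝ) ≤ Module.finrank ℝ (cs.fixedSpace l.prod) + l.length := by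
  have := finite_index cs
  induction l with
  | nil => rw [List.prod_nil, fixedSpace_one, finrank_top, List.length_nil, add_zero]
  | cons t l ih =>
    obtain ⟨ht, hl⟩ := List.forall_mem_cons.mp hl
    have hcodim := finrank_fixedSpace_add_one_of_isReflection cs ht
    have hprod := ih hl
    have hmul := finrank_fixedSpace_add_finrank_fixedSpace_le cs t l.prod
    rw [List.prod_cons, List.length_cons]
    omega

theorem reflectionLength_prod_le {l : List W} (hl : ∀ t ∈ l, cs.IsReflection t) :
    cs.reflectionLength l.prod ≤ l.length :=
  Nat.sInf_le ⟨l, hl, rfl, rfl⟩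

theorem reflectionLength_le_reflectionLength_mul_add_one {t : W} (ht : cs.IsReflection t)
    (w : W) : cs.reflectionLength w ≤ cs.reflectionLength (t * w) + 1 := by
  obtain ⟨l, hl, hprod, hlen⟩ := cs.exists_list_length_eq_reflectionLength (t * w)
  have hle := reflectionLength_prod_le cs (l := t :: l) (List.forall_mem_cons.mpr ⟨ht, hl⟩)
  rwa [List.prod_cons, hprod, ← mul_assoc, ht.mul_self, one_mul, List.length_cons, hlen] at hle

theorem reflectionLength_add_finrank_fixedSpace_le [Finite W] (w : W) :
    cs.reflectionLength w + Module.finrank ℝ (cs.fixedSpace w) ≤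
      Module.finrank ℝ (B →₀ ℝ) := by
  have := finite_index cs
  induction hF : cs.fixedSpace w using WellFoundedGT.induction generalizing w with
  | _ F ih =>
  subst hF
  rcases eq_or_ne w 1 with rfl | hw
  · have hone := reflectionLength_prod_le cs (l := []) (by simp)
    rw [List.prod_nil, List.length_nil] at hone
    rw [fixedSpace_one, finrank_top, Nat.le_zero.mp hone, zero_add]
  · obtain ⟨t, ht, hlt⟩ := exists_isReflection_fixedSpace_lt_fixedSpace_mul cs hw
    have hmul := ih _ hlt (t * w) rfl
    have hlen := reflectionLength_le_reflectionLength_mul_add_one cs ht w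
    have hrank := Submodule.finrank_lt_finrank_of_lt hlt
    omega

theorem reflectionLength_add_finrank_fixedSpace [Finite W] (w : W) :
    cs.reflectionLength w + Module.finrank ℝ (cs.fixedSpace w) = Module.finrank ℝ (B →₀ ℝ) := by
  refine le_antisymm (reflectionLength_add_finrank_fixedSpace_le cs w) ?_
  obtain ⟨l, hl, rfl, hlen⟩ := cs.exists_list_length_eq_reflectionLength w
  rw [← hlen, add_comm]
  exact finrank_le_finrank_fixedSpace_prod_add_length cs hl

end ReflectionLength

section Involutions

variable {B W : Type*} [Group W] [Finite W] {M : CoxeterMatrix B} (cs : CoxeterSystem M W)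
  {u v : W}

theorem absLE_iff_finrank_fixedSpace_add :
    cs.AbsLE v u ↔ Module.finrank ℝ (cs.fixedSpace v) +
      Module.finrank ℝ (cs.fixedSpace (v⁻¹ * u)) =
        Module.finrank ℝ (B →₀ ℝ) + Module.finrank ℝ (cs.fixedSpace u) := by
  have hv := reflectionLength_add_finrank_fixedSpace cs v
  have hvu := reflectionLength_add_finrank_fixedSpace cs (v⁻¹ * u)
  have hu := reflectionLength_add_finrank_fixedSpace cs u
  rw [CoxeterSystem.AbsLE]
  omega

theorem absLE_iff_fixedSpace_le_and_sup_eq_top :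
    cs.AbsLE v u ↔ cs.fixedSpace u ≤ cs.fixedSpace v ∧
      cs.fixedSpace v ⊔ cs.fixedSpace (v⁻¹ * u) = ⊤ := by
  have := finite_index cs
  have hinf : cs.fixedSpace v ⊓ cs.fixedSpace (v⁻¹ * u) ≤ cs.fixedSpace u := by
    simpa only [mul_inv_cancel_left] using fixedSpace_inf_le_fixedSpace_mul cs v (v⁻¹ * u)
  have hdim := Submodule.finrank_sup_add_finrank_inf_eq (cs.fixedSpace v)
    (cs.fixedSpace (v⁻¹ * u))
  rw [absLE_iff_finrank_fixedSpace_add]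
  constructor
  · intro h
    have hinf_le := Submodule.finrank_mono hinf
    have hsup_le := Submodule.finrank_le (cs.fixedSpace v ⊔ cs.fixedSpace (v⁻¹ * u))
    have hinf_eq := Submodule.eq_of_le_of_finrank_eq hinf (by omega)
    exact ⟨hinf_eq ▸ inf_le_left, Submodule.eq_top_of_finrank_eq (by omega)⟩
  · rintro ⟨hle, hsup⟩
    have hinf_eq : cs.fixedSpace v ⊓ cs.fixedSpace (v⁻¹ * u) = cs.fixedSpace u := by
      refine le_antisymm hinf (le_inf hle fun x hx => ?_)
      rw [fixedSpace_eq_fixedSubmodule, map_mul, map_inv, mem_fixedSubmodule_inv_mul_iff]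
      have hux : cs.geomRep u x = x := hx
      exact hux.trans (hle hx).symm
    rw [← hdim, hsup, hinf_eq, finrank_top]

theorem commute_of_fixedSpace_le (hu : u ^ 2 = 1) (huv : cs.fixedSpace u ≤ cs.fixedSpace v) :
    Commute u v := by
  have := finite_index cs
  obtain ⟨β, hβ⟩ := exists_isInvariantInner cs.geomRep
  have hρu : cs.geomRep u ^ 2 = 1 := by rw [← map_pow, hu, map_one]
  exact Commute.of_map (geomRep_injective cs) <| commute_of_fixedSubmodule_le hβ.nondegenerate
    hβ.isSymm.isRefl (hβ.isOrthogonal u) (hβ.isOrthogonal v) hρu huv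

theorem absLE_iff_sq_eq_one_and_fixedSpace_le (hu : u ^ 2 = 1) :
    cs.AbsLE v u ↔ v ^ 2 = 1 ∧ cs.fixedSpace u ≤ cs.fixedSpace v := by
  rw [absLE_iff_fixedSpace_le_and_sup_eq_top, and_comm, and_congr_left_iff]
  intro huv
  have hρu : cs.geomRep u ^ 2 = 1 := by rw [← map_pow, hu, map_one]
  have hsq : v ^ 2 = 1 ↔ cs.geomRep v ^ 2 = 1 := by
    rw [← map_pow, map_eq_one_iff _ (geomRep_injective cs)]
  have hcomm := (commute_of_fixedSpace_le cs hu huv).map cs.geomRep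
  rw [hsq, sq_eq_one_iff_fixedSubmodule_sup_eq_top hρu huv hcomm, ← map_inv, ← map_mul]
  rfl

end Involutions

end AbsoluteOrder

theorem mainTheorem5 {B W : Type*} [Group W] [Finite W] {M : CoxeterMatrix B}
    (cs : CoxeterSystem M W) (u : W) (hu : u ^ 2 = 1) (v : W) :
    List.TFAE [
      cs.AbsLE v u,
      v ^ 2 = 1 ∧ v ∈ cs.parabolicClosure u,
      v ^ 2 = 1 ∧ cs.fixedSpace u ≤ cs.fixedSpace v] ∧
    ((cs.AbsLE v u ∨ (v ^ 2 = 1 ∧ v ∈ cs.parabolicClosure u) ∨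
        (v ^ 2 = 1 ∧ cs.fixedSpace u ≤ cs.fixedSpace v)) →
      u * v = v * u) := by
  have h13 := AbsoluteOrder.absLE_iff_sq_eq_one_and_fixedSpace_le cs (v := v) hu
  have h23 : (v ^ 2 = 1 ∧ v ∈ cs.parabolicClosure u) ↔
      (v ^ 2 = 1 ∧ cs.fixedSpace u ≤ cs.fixedSpace v) :=
    and_congr_right fun _ => AbsoluteOrder.mem_parabolicClosure_iff cs
  constructor
  · tfae_have 1 ↔ 3 := h13
    tfae_have 2 ↔ 3 := h23
    tfae_finish
  · rw [h13, h23, or_self, or_self]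
    exact fun h => AbsoluteOrder.commute_of_fixedSpace_le cs hu h.2
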